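/- Let $p$ be a prime, let $f\colon\mathbb Z_p\to\mathbb Z_p$ be a 1-Lipschitz map, and let $b_0,b_1,b_2,\ldots\in\mathbb Z_p$ be its (normalized) van der Put coefficients, that is, $$f(x)=\sum_{m=0}^{\infty} b_m\,p^{\lfloor\log_p m\rfloor}\,\chi(m,x)\qquad\text{for all }x\in\mathbb Z_p,$$ where $\lfloor\log_p 0\rfloor=0$, and $\chi(m,x)=1$ if $|x-m|_p\le p^{-\lfloor\log_p m\rfloor-1}$ and $\chi(m,x)=0$ otherwise. Put $B_f=\{b_m : m=0,1,2,\ldots\}$. An automaton $\mathfrak A=\langle\mathbb F_p,\mathcal S,\mathbb F_p,S,O,s_0\rangle$ consists of a set $\mathcal S$ of states, a transition function $S\colon\mathbb F_p\times\mathcal S\to\mathcal S$, an output function $O\colon\mathbb F_p\times\mathcal S\to\mathbb F_p$ and an initial state $s_0\in\mathcal S$ from which every state is reachable by some finite input word; it is finite if $\mathcal S$ is finite. Writing $\delta_i(z)\in\mathbb F_p=\{0,1,\ldots,p-1\}$ for the $i$-th digit of the canonical $p$-adic expansion $z=\sum_{i\ge 0}\delta_i(z)p^i$, the automaton function $f_{\mathfrak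 A}\colon\mathbb Z_p\to\mathbb Z_p$ is defined by $\delta_i(f_{\mathfrak A}(z))=O(\delta_i(z),s_i)$ for $i\ge 0$, where $s_{i+1}=S(\delta_i(z),s_i)$. Then $f$ is the automaton function of a finite automaton if and only if the following two conditions hold simultaneously: 1. $B_f$ is a finite subset of $\mathbb Q\cap\mathbb Z_p$; 2. there exist an integer $\ell\ge 1$ and an injection $\tau\colon B_f\to\mathbb F_{p^\ell}$ such that the formal power series $\sum_{m=0}^{\infty}\tau(b_m)X^m$, regarded as an element of $\mathbb F_{p^\ell}((X))$, is algebraic over the field $\mathbb F_{p^\ell}(X)$ of rational functions. -/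

import Mathlib

namespace VdPAutomata

/-- An initial automaton (letter-to-letter transducer) with input and output alphabet `A` and a
(possibly infinite) set of states `S`. -/
structure Automaton (A S : Type*) where
  /-- the state transition function -/
  trans : A → S → S
  /-- the output function -/
  out : A → S → A
  /-- the initial state -/
  init : S

/-- Every state is reached from the initial state by some finite input word. The head of the list
is the letter that is fed first. -/
def Automaton.Reachable {A S : Type*} (M : Automaton A S) : Prop :=
  ∀ s : S, ∃ w : List A, w.foldl (fun t a => M.trans a t) M.init = s

/-- The `i`-th digit of the canonical `p`-adic expansion of `z`, as an element of `𝔽_p`: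
`z mod p ^ (i + 1)` has the least non-negative residue `d₀ + d₁ p + ⋯ + d_i p ^ i`. -/
noncomputable def digit (p : ℕ) [Fact p.Prime] (i : ℕ) (z : ℤ_[p]) : ZMod p :=
  (((PadicInt.toZModPow (i + 1) z).val / p ^ i : ℕ) : ZMod p)

/-- The state `s_i` of the automaton after the digits `0, …, i - 1` of `z` have been fed to it. -/
noncomputable def Automaton.stateAt {p : ℕ} [Fact p.Prime] {S : Type*}
    (M : Automaton (ZMod p) S) (z : ℤ_[p]) : ℕ → S
  | 0 => M.init
  | i + 1 => M.trans (digit p i z) (M.stateAt z i)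

/-- `f` is the automaton function of `M`: the `i`-th digit of `f z` is the `i`-th output symbol
of `M` on the sequence of digits of `z`. This determines `f`. -/
def Automaton.HasFunction {p : ℕ} [Fact p.Prime] {S : Type*}
    (M : Automaton (ZMod p) S) (f : ℤ_[p] → ℤ_[p]) : Prop :=
  ∀ (z : ℤ_[p]) (i : ℕ), digit p i (f z) = M.out (digit p i z) (M.stateAt z i)

/-- `f` is the automaton function of a finite (reachable) automaton over `𝔽_p`. -/
def IsFiniteAutomatonFunction {p : ℕ} [Fact p.Prime] (f : ℤ_[p] → ℤ_[p]) : Prop :=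
  ∃ (S : Type) (M : Automaton (ZMod p) S), Finite S ∧ M.Reachable ∧ M.HasFunction f

open Classical in
/-- The van der Put function `χ(m, ·)`: the characteristic function of the ball of radius
`p ^ (-n)` centered at `m`, where `n = ⌊log_p m⌋ + 1` is the number of base-`p` digits of `m`
(`n = 1` for `m = 0`; note that `Nat.log p 0 = 0`). -/
noncomputable def vdpChar (p : ℕ) [Fact p.Prime] (m : ℕ) (x : ℤ_[p]) : ℤ_[p] :=
  if ‖x - (m : ℤ_[p])‖ ≤ (p : ℝ) ^ (-((Nat.log p m + 1 : ℕ) : ℤ)) then 1 else 0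

/-- `f` is represented by the van der Put series
`f x = ∑ m, b_m p ^ ⌊log_p m⌋ χ(m, x)`, for all `x`. -/
def HasVanDerPutSeries {p : ℕ} [Fact p.Prime] (f : ℤ_[p] → ℤ_[p]) (b : ℕ → ℤ_[p]) : Prop :=
  ∀ x : ℤ_[p], HasSum (fun m : ℕ => b m * (p : ℤ_[p]) ^ Nat.log p m * vdpChar p m x) (f x)

/-- The set `ℚ ∩ ℤ_p` of rational `p`-adic integers. -/
def rationalPadicInts (p : ℕ) [Fact p.Prime] : Set ℤ_[p] :=
  {x | ∃ q : ℚ, (x : ℚ_[p]) = (q : ℚ_[p])}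

end VdPAutomata

namespace VdPAutomata

open PowerSeries
open scoped RatFunc

/-! ### Christol's theorem: from finitely many Cartier sections to algebraicity -/

section Christol

variable {K : Type*} [Field K] [Fintype K]

local notation "q" => Fintype.card K

/-! Three finiteness conditions are compared. By a Myhill–Nerode argument, `f` is computed by a
finite automaton iff it has finitely many sections `g`, the maps left after an input word
(`isFiniteAutomatonFunction_iff`).

Sections and coefficients are tied by `HasVanDerPutSeries.sect_sub`: if `g` is the section at `r < p
^ (k + 1)` and `n'` is `n ≠ 0` without its leading digit, then `g n - g n' = p ^ log n * b (r + p ^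
(k + 1) * n)`. So `g` fixes a member of the `p`-kernel of `b` up to its value at 0, and that member
together with `g 0` gives back `g` on the naturals, hence everywhere by continuity. If the sections
are finite in number, then so are the coefficients and the kernel, and values at naturals have
eventually periodic digits, so the coefficients are rational. Conversely, `g 0` evolves like a
carry, and finitely many rational coefficients allow only finitely many carries
(`exists_finite_carries`).

Finally, the `p`-kernel of `b` is finite iff that of `τ ∘ b` is, and Christol's theorem over a field
with `p ^ ℓ` elements equates this with algebraicity.

For the coefficient formula below: polynomials over the field satisfy `P ^ q = P(X ^ q)`, and the
part of `F` beyond degree `n` cannot reach coefficient `n`. -/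

theorem coeff_pow_card (F : K⟦X⟧) (n : ℕ) :
    coeff n (F ^ q) = if q ∣ n then coeff (n / q) F else 0 := by
  have h1 : F = ((trunc (n + 1) F : Polynomial K) : K⟦X⟧) +
      X ^ (n + 1) * mk fun i ↦ coeff (i + (n + 1)) F := by
    rw [mul_comm, add_comm (Polynomial.toPowerSeries _)]
    exact F.eq_shift_mul_X_pow_add_trunc (n + 1)
  have hq : 0 < q := Fintype.card_pos
  have h2 : F ^ q = ((Polynomial.expand K q (trunc (n + 1) F) : Polynomial K) : K⟦X⟧)
      + X ^ (n + 1) * (X ^ ((n + 1) * (q - 1)) * (mk fun i ↦ coeff (i + (n + 1)) F) ^ q) := by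
    conv_lhs => rw [h1]
    have := map_add (FiniteField.frobeniusAlgHom K K⟦X⟧) ((trunc (n + 1) F : Polynomial K) : K⟦X⟧)
      (X ^ (n + 1) * mk fun i ↦ coeff (i + (n + 1)) F)
    simp only [FiniteField.frobeniusAlgHom_apply] at this
    rw [this, FiniteField.expand_card, Polynomial.coe_pow, mul_pow, ← mul_assoc, ← pow_mul, ← pow_add]
    congr 3
    obtain ⟨k, hk⟩ := Nat.exists_eq_succ_of_ne_zero hq.ne'
    rw [hk]; simp; ring
  rw [h2, map_add, coeff_X_pow_mul', if_neg (by omega), add_zero, Polynomial.coeff_coe,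
    Polynomial.coeff_expand hq]
  split_ifs with h
  · rw [coeff_trunc, if_pos]
    exact Nat.lt_succ_of_le (Nat.div_le_self _ _)
  · rfl

/-- The series `∑ a_{qn+r} X^n` cut out of `∑ a_n X^n`, where `q` is the order of the field. -/
noncomputable def cartier (r : ℕ) (F : K⟦X⟧) : K⟦X⟧ := mk fun n ↦ coeff (q * n + r) F

theorem cartier_sum {ι : Type*} (r : ℕ) (s : Finset ι) (F : ι → K⟦X⟧) :
    cartier r (∑ i ∈ s, F i) = ∑ i ∈ s, cartier r (F i) := by
  ext n; simp [cartier]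

theorem cartier_X_pow_mul_pow {r s : ℕ} (hr : r < q) (hs : s < q) (F : K⟦X⟧) :
    cartier r (X ^ s * F ^ q) = if s = r then F else 0 := by
  ext n
  have hq : 0 < q := Fintype.card_pos
  rw [cartier, coeff_mk, coeff_X_pow_mul']
  split_ifs with h1 h2 h2
  · subst h2
    simp [coeff_pow_card, Nat.mul_div_cancel_left _ hq]
  · rw [coeff_pow_card, if_neg, map_zero]
    rintro ⟨k, hk⟩
    apply h2
    have : q * n + r = q * k + s := by omega
    have := congrArg (· % q) this
    simpa [Nat.mul_add_mod, Nat.mod_eq_of_lt hr, Nat.mod_eq_of_lt hs] using this.symm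
  · omega
  · simp

theorem eq_sum_cartier (F : K⟦X⟧) :
    F = ∑ s ∈ Finset.range q, X ^ s * (cartier s F) ^ q := by
  ext n
  have hq : 0 < q := Fintype.card_pos
  rw [map_sum, Finset.sum_eq_single (n % q)]
  · rw [coeff_X_pow_mul', if_pos (Nat.mod_le _ _), coeff_pow_card, if_pos (Nat.dvd_sub_mod n),
      cartier, coeff_mk]
    congr 1
    rw [Nat.mul_div_cancel' (Nat.dvd_sub_mod n), Nat.sub_add_cancel (Nat.mod_le n _)]
  · intro s hs hsn
    rw [coeff_X_pow_mul']
    split_ifs with h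
    · rw [coeff_pow_card, if_neg]
      intro hd
      apply hsn
      rw [← Nat.mod_eq_of_lt (Finset.mem_range.mp hs)]
      exact (Nat.modEq_iff_dvd' h).mpr hd
    · rfl
  · intro h
    exact absurd (Finset.mem_range.mpr (Nat.mod_lt _ hq)) h

/-- A `q`-th power is a series in `X ^ q`, so it passes through the operator and leaves as its root.
Both halves of Christol's theorem rest on this. -/
theorem cartier_mul_pow {r : ℕ} (hr : r < q) (F G : K⟦X⟧) :
    cartier r (F * G ^ q) = cartier r F * G := by
  have : F * G ^ q = ∑ s ∈ Finset.range q, X ^ s * (cartier s F * G) ^ q := by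
    conv_lhs => rw [eq_sum_cartier F]
    rw [Finset.sum_mul]
    exact Finset.sum_congr rfl fun s _ ↦ by ring
  rw [this, cartier_sum, Finset.sum_eq_single_of_mem r (Finset.mem_range.mpr hr)]
  · rw [cartier_X_pow_mul_pow hr hr, if_pos rfl]
  · intro s hs hsr
    rw [cartier_X_pow_mul_pow hr (Finset.mem_range.mp hs), if_neg hsr]

/-- The easy half of Christol's theorem. -/
theorem isAlgebraic_of_finite_cartier (𝓕 : Set K⟦X⟧) (hfin : 𝓕.Finite)
    (hcl : ∀ F ∈ 𝓕, ∀ r < q, cartier r F ∈ 𝓕) {F : K⟦X⟧} (hF : F ∈ 𝓕) :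
    IsAlgebraic (RatFunc K) (F : LaurentSeries K) := by
  have hq : 1 < q := Fintype.one_lt_card
  have : Finite 𝓕 := hfin
  -- Raising `eq_sum_cartier` to the power `q ^ N` shows that `V` is increasing. Hence, for `N` the
  -- size of `𝓕`, `V N` contains the `N + 1` powers `F ^ q ^ i` with `i ≤ N`, yet it is spanned by
  -- `N` elements.
  set V : ℕ → Submodule (RatFunc K) (LaurentSeries K) := fun N ↦
    Submodule.span _ (Set.range fun G : 𝓕 ↦ ((G : K⟦X⟧) : LaurentSeries K) ^ q ^ N) with hV
  have hmem : ∀ N, ∀ G ∈ 𝓕, (G : LaurentSeries K) ^ q ^ N ∈ V N := fun N G hG ↦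
    Submodule.subset_span ⟨⟨G, hG⟩, rfl⟩
  have hstep : ∀ N, V N ≤ V (N + 1) := by
    intro N
    refine Submodule.span_le.mpr ?_
    rintro _ ⟨⟨G, hG⟩, rfl⟩
    have h1 : (G : LaurentSeries K) ^ q ^ N = ∑ s ∈ Finset.range q,
        ((RatFunc.X : RatFunc K) ^ (s * q ^ N)) •
          ((cartier s G : K⟦X⟧) : LaurentSeries K) ^ q ^ (N + 1) := by
      have h2 : G ^ q ^ N = ∑ s ∈ Finset.range q, (X ^ s * (cartier s G) ^ q) ^ q ^ N := by
        have h3 := map_sum ((FiniteField.frobeniusAlgHom K K⟦X⟧) ^ N)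
          (fun s ↦ X ^ s * (cartier s G) ^ q) (Finset.range q)
        simp only [AlgHom.coe_pow, FiniteField.coe_frobeniusAlgHom, pow_iterate] at h3
        rw [← eq_sum_cartier G] at h3
        exact h3
      rw [← PowerSeries.coe_pow, h2, map_sum]
      refine Finset.sum_congr rfl fun s _ ↦ ?_
      rw [Algebra.smul_def, mul_pow, ← pow_mul, ← pow_mul, ← pow_succ', map_mul, map_pow, map_pow, map_pow]
      congr 2
      simp [RatFunc.coe_X]
    change (G : LaurentSeries K) ^ q ^ N ∈ V (N + 1)
    rw [h1]
    exact Submodule.sum_mem _ fun s hs ↦ Submodule.smul_mem _ _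
      (hmem _ _ (hcl G hG s (Finset.mem_range.mp hs)))
  have hmono : Monotone V := monotone_nat_of_le_succ hstep
  by_contra htr
  have hli : LinearIndependent (RatFunc K) fun i : ℕ ↦ (F : LaurentSeries K) ^ i := by
    have h := (Polynomial.basisMonomials (RatFunc K)).linearIndependent.map'
      (Polynomial.aeval (F : LaurentSeries K)).toLinearMap
      (LinearMap.ker_eq_bot.mpr (transcendental_iff_injective.mp htr))
    have heq : (fun i : ℕ ↦ (F : LaurentSeries K) ^ i) =
        (Polynomial.aeval (F : LaurentSeries K)).toLinearMap ∘
          Polynomial.basisMonomials (RatFunc K) := by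
      ext1 i
      simp
    rw [heq]
    exact h
  set N := Nat.card 𝓕
  have : FiniteDimensional (RatFunc K) (V N) := FiniteDimensional.span_of_finite _ (Set.finite_range _)
  have hli2 : LinearIndependent (RatFunc K) fun i : Fin (N + 1) ↦
      (⟨(F : LaurentSeries K) ^ q ^ (i : ℕ), hmono (Nat.lt_succ_iff.mp i.2) (hmem i F hF)⟩ : V N) := by
    apply LinearIndependent.of_comp (V N).subtype
    exact hli.comp (fun i : Fin (N + 1) ↦ q ^ (i : ℕ))
      fun i j h ↦ Fin.ext (Nat.pow_right_injective hq h)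
  have h1 := hli2.fintype_card_le_finrank
  have : Fintype 𝓕 := hfin.fintype
  have h2 := finrank_range_le_card (R := RatFunc K)
    (fun G : 𝓕 ↦ ((G : K⟦X⟧) : LaurentSeries K) ^ q ^ N)
  rw [Fintype.card_fin] at h1
  have h3 : Fintype.card 𝓕 = N := Nat.card_eq_fintype_card.symm
  have := h1.trans h2
  omega

end Christol

/-! ### Christol's theorem: from algebraicity to finitely many Cartier sections -/

section Polynomials

variable {K : Type*} [Field K]

/-- The power series that are polynomials of degree at most `M`. -/
def degLE (K : Type*) [Field K] (M : ℕ) : Set K⟦X⟧ := {P | ∀ n, M < n → coeff n P = 0}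

theorem degLE_mono {M N : ℕ} (h : M ≤ N) : degLE K M ⊆ degLE K N :=
  fun _ hP n hn ↦ hP n (h.trans_lt hn)

theorem zero_mem_degLE (M : ℕ) : (0 : K⟦X⟧) ∈ degLE K M := fun n _ ↦ by simp

theorem sub_mem_degLE {M : ℕ} {P Q : K⟦X⟧} (hP : P ∈ degLE K M) (hQ : Q ∈ degLE K M) :
    P - Q ∈ degLE K M := fun n hn ↦ by rw [map_sub, hP n hn, hQ n hn, sub_zero]

theorem mul_mem_degLE {M N : ℕ} {P Q : K⟦X⟧} (hP : P ∈ degLE K M) (hQ : Q ∈ degLE K N) :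
    P * Q ∈ degLE K (M + N) := by
  intro n hn
  rw [coeff_mul]
  refine Finset.sum_eq_zero fun ij hij ↦ ?_
  have := Finset.HasAntidiagonal.mem_antidiagonal.mp hij
  by_cases h : M < ij.1
  · rw [hP _ h, zero_mul]
  · rw [hQ _ (by omega), mul_zero]

theorem pow_mem_degLE {M : ℕ} {P : K⟦X⟧} (hP : P ∈ degLE K M) (e : ℕ) :
    P ^ e ∈ degLE K (e * M) := by
  induction e with
  | zero =>
    intro n hn
    rw [pow_zero, coeff_one, if_neg (by omega)]
  | succ e ih =>
    rw [pow_succ, Nat.succ_mul]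
    exact mul_mem_degLE ih hP

variable [Fintype K]

local notation "q" => Fintype.card K

theorem finite_degLE (M : ℕ) : (degLE K M).Finite := by
  refine Set.Finite.of_finite_image (f := fun P (i : Fin (M + 1)) ↦ coeff (i : ℕ) P)
    (Set.toFinite _) ?_
  intro P hP Q hQ h
  ext n
  by_cases hn : M < n
  · rw [hP n hn, hQ n hn]
  · exact congrFun h ⟨n, by omega⟩

/-- The operator divides degrees by `q ≥ 2`, which absorbs a doubling of the bound. -/
theorem cartier_mem_degLE {M N r : ℕ} {P : K⟦X⟧} (hP : P ∈ degLE K (M + N)) (hMN : N ≤ M) :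
    cartier r P ∈ degLE K M := by
  intro n hn
  have hq : 1 < q := Fintype.one_lt_card
  rw [cartier, coeff_mk, hP]
  nlinarith

/-- The powers `F ^ q ^ i` all lie in a finite extension of `K(X)`, so they are dependent; passing
to the fraction ring clears denominators. -/
theorem exists_frobenius_relation {F : K⟦X⟧}
    (hF : IsAlgebraic (RatFunc K) (F : LaurentSeries K)) :
    ∃ (n M : ℕ) (c : ℕ → K⟦X⟧), (∀ i, c i ∈ degLE K M) ∧
      ∑ i ∈ Finset.range n, c i * F ^ q ^ i = 0 ∧ ∃ i < n, c i ≠ 0 := by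
  have hdep : ¬ LinearIndependent (Polynomial K) fun i : ℕ ↦ (F : LaurentSeries K) ^ q ^ i := by
    rw [LinearIndependent.iff_fractionRing (Polynomial K) (RatFunc K)]
    intro hli
    have := IntermediateField.adjoin.finiteDimensional hF.isIntegral
    have hx := IntermediateField.mem_adjoin_simple_self (RatFunc K) (F : LaurentSeries K)
    have hli2 : LinearIndependent (RatFunc K) fun i : ℕ ↦
        (⟨(F : LaurentSeries K) ^ q ^ i, pow_mem hx _⟩ :
          IntermediateField.adjoin (RatFunc K) {(F : LaurentSeries K)}) :=
      LinearIndependent.of_comp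
        (IntermediateField.adjoin (RatFunc K) {(F : LaurentSeries K)}).val.toLinearMap hli
    exact not_finite_iff_infinite.mpr inferInstance hli2.finite
  obtain ⟨s, g, hsum, j, hjs, hj⟩ := not_linearIndependent_iff.mp hdep
  refine ⟨s.sup id + 1, s.sup fun i ↦ (g i).natDegree,
    fun i ↦ if i ∈ s then (g i : K⟦X⟧) else 0, ?_, ?_, j, ?_, ?_⟩
  · intro i n hn
    dsimp only
    split_ifs with his
    · rw [Polynomial.coeff_coe, Polynomial.coeff_eq_zero_of_natDegree_lt]
      exact (Finset.le_sup (f := fun i ↦ (g i).natDegree) his).trans_lt hn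
    · simp
  · have hsub : s ⊆ Finset.range (s.sup id + 1) := fun i hi ↦
      Finset.mem_range.mpr (Nat.lt_succ_of_le (Finset.le_sup (f := id) hi))
    rw [← Finset.sum_subset hsub fun i _ hi ↦ by simp only [if_neg hi, zero_mul]]
    apply HahnSeries.ofPowerSeries_injective (Γ := ℤ)
    rw [map_zero, ← hsum, map_sum]
    refine Finset.sum_congr rfl fun i hi ↦ ?_
    simp only [if_pos hi]
    rw [Algebra.smul_def, map_mul, map_pow]
    rfl
  · exact Nat.lt_succ_of_le (Finset.le_sup (f := id) hjs)
  · simpa [hjs] using hj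

/-- If `c 0 = 0`, every power of `F` in the relation is a `q`-th power, and a Cartier operator
lowers all exponents one level. Choosing `r` so that some nonzero coefficient survives keeps the
relation nontrivial. -/
theorem exists_frobenius_relation_head_ne_zero {F : K⟦X⟧}
    (hF : IsAlgebraic (RatFunc K) (F : LaurentSeries K)) :
    ∃ (n M : ℕ) (c : ℕ → K⟦X⟧), (∀ i, c i ∈ degLE K M) ∧
      ∑ i ∈ Finset.range (n + 1), c i * F ^ q ^ i = 0 ∧ c 0 ≠ 0 := by
  obtain ⟨n, M, c, hc, hsum, hne⟩ := exists_frobenius_relation hF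
  induction n generalizing c with
  | zero => obtain ⟨i, hi, -⟩ := hne; omega
  | succ n ih =>
    by_cases h0 : c 0 = 0
    · obtain ⟨i, hi, hci⟩ := hne
      obtain ⟨i, rfl⟩ : ∃ k, i = k + 1 :=
        Nat.exists_eq_succ_of_ne_zero (by rintro rfl; exact hci h0)
      obtain ⟨r, hr, hcr⟩ : ∃ r < q, cartier r (c (i + 1)) ≠ 0 := by
        by_contra! h
        apply hci
        rw [eq_sum_cartier (c (i + 1))]
        refine Finset.sum_eq_zero fun s hs ↦ ?_
        rw [h s (Finset.mem_range.mp hs), zero_pow Fintype.card_ne_zero, mul_zero]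
      refine ih (fun j ↦ cartier r (c (j + 1)))
        (fun j ↦ cartier_mem_degLE (N := 0) (hc (j + 1)) (Nat.zero_le _)) ?_ ⟨i, by omega, hcr⟩
      rw [Finset.sum_range_succ', h0, zero_mul, add_zero] at hsum
      have := congrArg (cartier r) hsum
      rw [cartier_sum] at this
      have hz : cartier r (0 : K⟦X⟧) = 0 := by ext; simp [cartier]
      rw [hz] at this
      rw [← this]
      refine Finset.sum_congr rfl fun j _ ↦ ?_
      rw [pow_succ q j, pow_mul F, cartier_mul_pow hr]
    · exact ⟨n, M, c, hc, hsum, h0⟩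

/-- Put `G = F / u` with `u = c 0`. The family consists of the power series `∑ a i * G ^ q ^ i`, `i
≤ n`, with `a i` of bounded degree, written with denominators cleared by `u ^ q ^ n`. The relation
gives `G = -∑ c i * u ^ (q ^ i - 2) * G ^ q ^ i` over `i ≥ 1`. Substituting this for the term `i =
0` leaves only `q`-th powers of `G`, from which a Cartier operator extracts roots. -/
theorem exists_finite_cartier_of_isAlgebraic {F : K⟦X⟧}
    (hF : IsAlgebraic (RatFunc K) (F : LaurentSeries K)) :
    ∃ 𝓕 : Set K⟦X⟧, 𝓕.Finite ∧ F ∈ 𝓕 ∧ ∀ G ∈ 𝓕, ∀ r < q, cartier r G ∈ 𝓕 := by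
  obtain ⟨n, D, c, hc, hsum, h0⟩ := exists_frobenius_relation_head_ne_zero hF
  have hq : 1 < q := Fintype.one_lt_card
  set u := c 0 with hu
  set t : (ℕ → K⟦X⟧) → K⟦X⟧ := fun a ↦
    ∑ i ∈ Finset.range (n + 1), a i * (u ^ (q ^ n - q ^ i) * F ^ q ^ i) with ht
  -- The substitution adds at most `D + q ^ n * D` to the degrees, so the new coefficients have
  -- degree at most `2 * M`, and `cartier_mem_degLE` brings them back to `M`.
  set M := D + q ^ n * D
  set A : Set (ℕ → K⟦X⟧) := {a | ∀ i, if i ≤ n then a i ∈ degLE K M else a i = 0} with hA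
  have hAfin : A.Finite := by
    refine Set.Finite.subset (Set.Finite.image (fun (a : Fin (n + 1) → K⟦X⟧) (i : ℕ) ↦
      if h : i < n + 1 then a ⟨i, h⟩ else 0)
      (Set.Finite.pi' fun _ : Fin (n + 1) ↦ finite_degLE (K := K) M)) ?_
    intro a ha
    refine ⟨fun i ↦ a i, fun i ↦ ?_, ?_⟩
    · have := ha i
      rwa [if_pos (by omega)] at this
    · ext1 i
      have := ha i
      dsimp only
      split_ifs at this ⊢ with h1 h2 h2
      · rfl
      · omega
      · omega
      · exact this.symm
  have huq : u ^ q ^ n ≠ 0 := pow_ne_zero _ h0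
  refine ⟨{H | ∃ a ∈ A, u ^ q ^ n * H = t a}, ?_, ?_, ?_⟩
  · refine Set.Finite.of_finite_image (f := fun H ↦ u ^ q ^ n * H)
      ((hAfin.image t).subset ?_) fun H _ H' _ h ↦ mul_left_cancel₀ huq h
    rintro _ ⟨H, ⟨a, ha, h⟩, rfl⟩
    exact ⟨a, ha, h.symm⟩
  · refine ⟨fun i ↦ if i = 0 then u else 0, fun i ↦ ?_, ?_⟩
    · dsimp only
      split_ifs with h1 h2 h2
      · exact degLE_mono (Nat.le_add_right _ _) (hc 0)
      · exact zero_mem_degLE M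
      · omega
      · rfl
    · rw [ht]
      dsimp only
      rw [Finset.sum_eq_single_of_mem 0 (by simp) (by intro i _ hi; rw [if_neg hi, zero_mul]),
        if_pos rfl, pow_zero, pow_one, ← mul_assoc, ← pow_succ',
        Nat.sub_add_cancel (Nat.one_le_pow _ _ (by omega))]
  · rintro H ⟨a, ha, hH⟩ r hr
    set e : ℕ → K⟦X⟧ := fun i ↦ a (i + 1) - a 0 * (c (i + 1) * u ^ (q ^ (i + 1) - 2)) with he
    have hle : ∀ i ≤ n, q ^ i ≤ q ^ n := fun i hi ↦ Nat.pow_le_pow_right (by omega) hi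
    have key : H * (u ^ q ^ n) ^ q =
        ∑ i ∈ Finset.range n, e i * (u ^ (q ^ n - q ^ i) * F ^ q ^ i) ^ q := by
      have hn2 : q ^ n ≤ q ^ (n + 1) := Nat.pow_le_pow_right (by omega) (by omega)
      have h2 : ∀ i, 2 ≤ q ^ (i + 1) := fun i ↦
        hq.trans_le (Nat.le_self_pow (Nat.succ_ne_zero i) q)
      have hterm : ∀ i ∈ Finset.range n, (u ^ (q ^ n - q ^ i) * F ^ q ^ i) ^ q
          = u ^ (q ^ (n + 1) - q ^ (i + 1)) * F ^ q ^ (i + 1) := fun i _ ↦ by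
        rw [mul_pow, ← pow_mul, ← pow_mul, Nat.sub_mul, ← pow_succ, ← pow_succ]
      have h1 : H * (u ^ q ^ n) ^ q = u ^ (q ^ (n + 1) - q ^ n) * t a := by
        rw [← hH, ← mul_assoc, ← pow_add, Nat.sub_add_cancel hn2, ← pow_mul, ← pow_succ, mul_comm]
      have h3 : t a = ∑ i ∈ Finset.range n, a (i + 1) * (u ^ (q ^ n - q ^ (i + 1)) * F ^ q ^ (i + 1))
          + a 0 * (u ^ (q ^ n - 1) * F) := by
        rw [ht]; dsimp only
        rw [Finset.sum_range_succ', pow_zero, pow_one]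
      have h4 : u * F = - ∑ i ∈ Finset.range n, c (i + 1) * F ^ q ^ (i + 1) := by
        rw [Finset.sum_range_succ', pow_zero, pow_one] at hsum
        exact eq_neg_of_add_eq_zero_right hsum
      have h5 : u ^ (q ^ (n + 1) - q ^ n) * (a 0 * (u ^ (q ^ n - 1) * F)) =
          a 0 * (u ^ (q ^ (n + 1) - 2) * (u * F)) := by
        have h6 : u ^ (q ^ (n + 1) - q ^ n) * u ^ (q ^ n - 1) = u ^ (q ^ (n + 1) - 2) * u := by
          rw [← pow_add, ← pow_succ]
          have := h2 n
          have := Nat.one_le_pow n q (by omega)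
          congr 1
          omega
        linear_combination a 0 * F * h6
      rw [h1, h3, mul_add, h5, h4, mul_neg, mul_neg, Finset.mul_sum, Finset.mul_sum,
        Finset.mul_sum, ← sub_eq_add_neg, ← Finset.sum_sub_distrib]
      refine Finset.sum_congr rfl fun i hi ↦ ?_
      have hin : q ^ (i + 1) ≤ q ^ n := hle _ (Finset.mem_range.mp hi)
      rw [hterm i hi]
      have h6 : u ^ (q ^ (n + 1) - q ^ n) * u ^ (q ^ n - q ^ (i + 1))
          = u ^ (q ^ (n + 1) - q ^ (i + 1)) := by
        rw [← pow_add]; congr 1; omega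
      have h7 : u ^ (q ^ (n + 1) - 2)
          = u ^ (q ^ (i + 1) - 2) * u ^ (q ^ (n + 1) - q ^ (i + 1)) := by
        have := h2 i
        rw [← pow_add]; congr 1; omega
      rw [he]
      linear_combination a (i + 1) * F ^ q ^ (i + 1) * h6 - a 0 * c (i + 1) * F ^ q ^ (i + 1) * h7
    refine ⟨fun i ↦ if i < n then cartier r (e i) else 0, fun i ↦ ?_, ?_⟩
    · dsimp only
      split_ifs with h1 h2 h2
      · refine cartier_mem_degLE (M := M) (N := M) (sub_mem_degLE ?_ ?_) le_rfl
        · have := ha (i + 1)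
          rw [if_pos (by omega)] at this
          exact degLE_mono (Nat.le_add_right _ _) this
        · have h3 := ha 0
          rw [if_pos (Nat.zero_le _)] at h3
          refine mul_mem_degLE h3 (degLE_mono ?_ (mul_mem_degLE (hc _) (pow_mem_degLE (hc 0) _)))
          exact Nat.add_le_add_left (Nat.mul_le_mul_right _ ((Nat.sub_le _ _).trans (hle _ h2))) _
      · exact zero_mem_degLE M
      · omega
      · rfl
    · have h1 := congrArg (cartier r) key
      rw [cartier_mul_pow hr, cartier_sum] at h1
      rw [mul_comm, h1, ht]
      dsimp only
      rw [Finset.sum_range_succ, if_neg (lt_irrefl n), zero_mul, add_zero]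
      refine Finset.sum_congr rfl fun i hi ↦ ?_
      rw [cartier_mul_pow hr, if_pos (Finset.mem_range.mp hi)]

end Polynomials

end VdPAutomata

namespace VdPAutomata

theorem add_mul_lt_mul {a b c d : ℕ} (ha : a < b) (hc : c < d) : a + b * c < b * d :=
  calc a + b * c < b * (c + 1) := by rw [mul_add, mul_one, add_comm]; omega
    _ ≤ b * d := Nat.mul_le_mul_left _ hc

/-! ### Digits and the shift on `p`-adic integers -/

section Digits

variable {p : ℕ} [Fact p.Prime]

theorem digit_eq_of_eq {z t : ℤ_[p]} {i a d : ℕ} (ha : a < p ^ i) (hd : d < p)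
    (hz : z = a + p ^ i * (d + p * t)) : digit p i z = d := by
  have h1 : PadicInt.toZModPow (i + 1) z = ((a + p ^ i * d : ℕ) : ZMod (p ^ (i + 1))) := by
    have h2 : z = ((a + p ^ i * d : ℕ) : ℤ_[p]) + ((p ^ (i + 1) : ℕ) : ℤ_[p]) * t := by
      rw [hz]; push_cast; ring
    rw [h2, map_add, map_mul, map_natCast, map_natCast, ZMod.natCast_self, zero_mul, add_zero]
  have h3 : a + p ^ i * d < p ^ (i + 1) := by
    rw [pow_succ]
    exact add_mul_lt_mul ha hd
  have hpos : 0 < p ^ i := (Nat.zero_le a).trans_lt ha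
  rw [digit, h1, ZMod.val_natCast_of_lt h3, Nat.add_mul_div_left _ _ hpos,
    Nat.div_eq_of_lt ha, zero_add]

theorem exists_eq_add_pow_mul (z : ℤ_[p]) (i : ℕ) :
    ∃ a < p ^ i, ∃ t : ℤ_[p], z = a + p ^ i * t := by
  obtain ⟨t, ht⟩ := Ideal.mem_span_singleton.mp (PadicInt.appr_spec i z)
  exact ⟨z.appr i, PadicInt.appr_lt z i, t, by rw [← ht]; ring⟩

theorem exists_eq_digit_add (z : ℤ_[p]) : ∃ t : ℤ_[p], z = (digit p 0 z).val + p * t := by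
  obtain ⟨d, hd, t, ht⟩ := exists_eq_add_pow_mul z 1
  rw [pow_one] at hd ht
  refine ⟨t, ?_⟩
  rw [digit_eq_of_eq (a := 0) (t := t) (by simp) hd (by simpa using ht), ZMod.val_natCast_of_lt hd]
  exact ht

/-- The `p`-adic integer obtained from `z` by deleting its lowest digit. -/
noncomputable def tail (z : ℤ_[p]) : ℤ_[p] := (exists_eq_digit_add z).choose

theorem eq_digit_add_tail (z : ℤ_[p]) : z = (digit p 0 z).val + p * tail z :=
  (exists_eq_digit_add z).choose_spec

theorem digit_zero_add_mul (d : ZMod p) (x : ℤ_[p]) : digit p 0 (d.val + p * x : ℤ_[p]) = d := by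
  rw [digit_eq_of_eq (a := 0) (t := x) (by simp) (ZMod.val_lt d) (by simp), ZMod.natCast_zmod_val]

theorem p_ne_zero : (p : ℤ_[p]) ≠ 0 := Nat.cast_ne_zero.mpr (Fact.out : p.Prime).ne_zero

theorem tail_add_mul (d : ZMod p) (x : ℤ_[p]) : tail (d.val + p * x : ℤ_[p]) = x := by
  have h := eq_digit_add_tail (d.val + p * x : ℤ_[p])
  rw [digit_zero_add_mul] at h
  exact (mul_left_cancel₀ p_ne_zero (add_left_cancel h)).symm

theorem digit_succ (i : ℕ) (z : ℤ_[p]) : digit p (i + 1) z = digit p i (tail z) := by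
  obtain ⟨a, ha, t, ht⟩ := exists_eq_add_pow_mul (tail z) i
  rw [digit_eq_of_eq (t := tail t) ha (ZMod.val_lt (digit p 0 t)) (by rw [← eq_digit_add_tail, ← ht])]
  refine digit_eq_of_eq (a := (digit p 0 z).val + p * a) (t := tail t) ?_ (ZMod.val_lt _) ?_
  · rw [pow_succ']
    exact add_mul_lt_mul (ZMod.val_lt _) ha
  · conv_lhs => rw [eq_digit_add_tail z, ht]
    rw [← eq_digit_add_tail]
    push_cast
    ring

theorem sub_eq_mul_tail_sub {z w : ℤ_[p]} (h : digit p 0 z = digit p 0 w) :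
    z - w = p * (tail z - tail w) := by
  conv_lhs => rw [eq_digit_add_tail z, eq_digit_add_tail w, h]
  ring

theorem eq_zero_of_forall_pow_dvd {z : ℤ_[p]} (h : ∀ n : ℕ, (p : ℤ_[p]) ^ n ∣ z) : z = 0 := by
  apply PadicInt.ext_of_toZModPow.mp
  intro n
  rw [map_zero, ← RingHom.mem_ker, PadicInt.ker_toZModPow]
  exact Ideal.mem_span_singleton.mpr (h n)

theorem eq_of_forall_digit_eq {z w : ℤ_[p]} (h : ∀ i, digit p i z = digit p i w) : z = w := by
  refine sub_eq_zero.mp (eq_zero_of_forall_pow_dvd fun n ↦ ?_)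
  induction n generalizing z w with
  | zero => simp
  | succ n ih =>
    rw [sub_eq_mul_tail_sub (h 0), pow_succ']
    exact mul_dvd_mul_left _ (ih fun i ↦ by rw [← digit_succ, ← digit_succ, h])

theorem digit_zero_eq_of_dvd {z w : ℤ_[p]} (h : (p : ℤ_[p]) ∣ z - w) :
    digit p 0 z = digit p 0 w := by
  obtain ⟨t, ht⟩ := h
  have : z = (digit p 0 w).val + p * (tail w + t) := by
    rw [mul_add, ← add_assoc, ← eq_digit_add_tail, ← ht]; ring
  rw [this, digit_zero_add_mul]

/-- The shift is not additive because of carries, but equal low digits cancel without a borrow. -/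
theorem sub_eq_pow_mul_tail_iterate {k : ℕ} {z w : ℤ_[p]} (h : (p : ℤ_[p]) ^ k ∣ z - w) :
    z - w = p ^ k * (tail^[k] z - tail^[k] w) := by
  induction k generalizing z w with
  | zero => simp
  | succ k ih =>
    have h1 := sub_eq_mul_tail_sub (digit_zero_eq_of_dvd (dvd_trans (dvd_pow_self _ k.succ_ne_zero) h))
    rw [h1, pow_succ'] at h
    rw [h1, ih ((mul_dvd_mul_iff_left p_ne_zero).mp h), Function.iterate_succ_apply,
      Function.iterate_succ_apply, pow_succ']
    ring

theorem exists_eq_add_pow_mul_tail_iterate (z : ℤ_[p]) (k : ℕ) :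
    ∃ a : ℕ, z = a + p ^ k * tail^[k] z := by
  induction k generalizing z with
  | zero => exact ⟨0, by simp⟩
  | succ k ih =>
    obtain ⟨a, ha⟩ := ih (tail z)
    refine ⟨(digit p 0 z).val + p * a, ?_⟩
    conv_lhs => rw [eq_digit_add_tail z, ha]
    rw [Function.iterate_succ_apply]
    push_cast
    ring

end Digits

/-! ### Finite automata and finiteness of the set of sections -/

section Sections

theorem add_pow_mul_lt_pow {p k r d : ℕ} (hr : r < p ^ k) (hd : d < p) :
    r + p ^ k * d < p ^ (k + 1) := by
  rw [pow_succ]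
  exact add_mul_lt_mul hr hd

variable {p : ℕ} [Fact p.Prime]

theorem pow_dvd_sub_of_lipschitz {f : ℤ_[p] → ℤ_[p]} (hf : LipschitzWith 1 f) {k : ℕ}
    {x y : ℤ_[p]} (h : (p : ℤ_[p]) ^ k ∣ x - y) : (p : ℤ_[p]) ^ k ∣ f x - f y := by
  rw [← Ideal.mem_span_singleton, ← PadicInt.norm_le_pow_iff_mem_span_pow] at h ⊢
  have := hf.dist_le_mul x y
  rw [dist_eq_norm, dist_eq_norm, NNReal.coe_one, one_mul] at this
  exact this.trans h

/-- The section of `f` at the word formed by the `k` lowest digits of `r`: the map describing how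
the higher digits of `f` depend on the higher digits of the argument. -/
noncomputable def sect (f : ℤ_[p] → ℤ_[p]) (k r : ℕ) (x : ℤ_[p]) : ℤ_[p] :=
  tail^[k] (f (r + p ^ k * x))

/-- A pair `(k, r)` encodes an input word of length `k`, lowest digit first; zeros at the high end
count, so `r` alone does not determine the word. -/
def sections (f : ℤ_[p] → ℤ_[p]) : Set (ℤ_[p] → ℤ_[p]) :=
  {g | ∃ k, ∃ r < p ^ k, g = sect f k r}

theorem sect_succ (f : ℤ_[p] → ℤ_[p]) (k r d : ℕ) (x : ℤ_[p]) :
    sect f (k + 1) (r + p ^ k * d) x = tail (sect f k r (d + p * x)) := by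
  rw [sect, sect, Function.iterate_succ_apply']
  congr 3
  push_cast
  ring

theorem pow_mul_sect_sub {f : ℤ_[p] → ℤ_[p]} (hf : LipschitzWith 1 f) (k r : ℕ) (x y : ℤ_[p]) :
    (p : ℤ_[p]) ^ k * (sect f k r x - sect f k r y) = f (r + p ^ k * x) - f (r + p ^ k * y) :=
  (sub_eq_pow_mul_tail_iterate (pow_dvd_sub_of_lipschitz hf ⟨x - y, by ring⟩)).symm

theorem pow_dvd_sect_sub {f : ℤ_[p] → ℤ_[p]} (hf : LipschitzWith 1 f) (k r : ℕ) {n : ℕ}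
    {x y : ℤ_[p]} (h : (p : ℤ_[p]) ^ n ∣ x - y) :
    (p : ℤ_[p]) ^ n ∣ sect f k r x - sect f k r y := by
  rw [← mul_dvd_mul_iff_left (pow_ne_zero k p_ne_zero), pow_mul_sect_sub hf, ← pow_add]
  refine pow_dvd_sub_of_lipschitz hf ?_
  rw [add_sub_add_left_eq_sub, ← mul_sub, pow_add]
  exact mul_dvd_mul_left _ h

theorem exists_eq_add_of_lt_pow {k r : ℕ} (hr : r < p ^ (k + 1)) :
    ∃ r' < p ^ k, ∃ d < p, r = r' + p ^ k * d := by
  have hp : 0 < p ^ k := pow_pos (Fact.out : p.Prime).pos k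
  exact ⟨r % p ^ k, Nat.mod_lt _ hp, r / p ^ k,
    Nat.div_lt_of_lt_mul (by rwa [← pow_succ]), (Nat.mod_add_div r _).symm⟩

/-- The automaton `M` started in the state `s`. -/
def Automaton.withInit {A S : Type*} (M : Automaton A S) (s : S) : Automaton A S :=
  ⟨M.trans, M.out, s⟩

theorem stateAt_add_mul {S : Type*} (M : Automaton (ZMod p) S) (d : ZMod p) (x : ℤ_[p]) (i : ℕ) :
    M.stateAt (d.val + p * x) (i + 1) =
      (M.withInit (M.trans d M.init)).stateAt x i := by
  induction i with
  | zero =>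
    rw [Automaton.stateAt, Automaton.stateAt, Automaton.stateAt, digit_zero_add_mul]
    rfl
  | succ i ih =>
    rw [Automaton.stateAt, ih, digit_succ, tail_add_mul, Automaton.stateAt]
    rfl

theorem hasFunction_tail {S : Type*} {M : Automaton (ZMod p) S} {f : ℤ_[p] → ℤ_[p]}
    (h : M.HasFunction f) (d : ZMod p) :
    (M.withInit (M.trans d M.init)).HasFunction
      fun x ↦ tail (f (d.val + p * x)) := by
  intro x i
  rw [← digit_succ, h, stateAt_add_mul, digit_succ, tail_add_mul]
  rfl

theorem exists_hasFunction_sect {S : Type*} {M : Automaton (ZMod p) S} {f : ℤ_[p] → ℤ_[p]}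
    (h : M.HasFunction f) (k : ℕ) : ∀ r < p ^ k, ∃ s : S,
      (M.withInit s).HasFunction (sect f k r) := by
  induction k with
  | zero =>
    intro r hr
    obtain rfl : r = 0 := by simpa using hr
    refine ⟨M.init, ?_⟩
    have : sect f 0 0 = f := by ext1 x; simp [sect]
    rw [this]
    exact h
  | succ k ih =>
    intro r hr
    obtain ⟨r, hr', d, hd, rfl⟩ := exists_eq_add_of_lt_pow hr
    obtain ⟨s, hs⟩ := ih r hr'
    refine ⟨M.trans d s, ?_⟩
    have h1 := hasFunction_tail hs (d : ZMod p)
    rw [ZMod.val_natCast_of_lt hd] at h1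
    have h2 : sect f (k + 1) (r + p ^ k * d) = fun x ↦ tail (sect f k r (d + p * x)) :=
      funext fun x ↦ sect_succ f k r d x
    rw [h2]
    exact h1

theorem hasFunction_unique {S : Type*} {M : Automaton (ZMod p) S} {f g : ℤ_[p] → ℤ_[p]}
    (hf : M.HasFunction f) (hg : M.HasFunction g) : f = g :=
  funext fun x ↦ eq_of_forall_digit_eq fun i ↦ by rw [hf, hg]

/-- Each section is computed by the automaton started in some state, and a state computes only one
function. -/
theorem finite_sections_of_isFiniteAutomatonFunction {f : ℤ_[p] → ℤ_[p]}
    (h : IsFiniteAutomatonFunction f) : (sections f).Finite := by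
  obtain ⟨S, M, _, -, hM⟩ := h
  have hex : ∀ g : sections f, ∃ s : S,
      (M.withInit s).HasFunction g := by
    rintro ⟨_, k, r, hr, rfl⟩
    exact exists_hasFunction_sect hM k r hr
  choose φ hφ using hex
  have : Finite (sections f) := Finite.of_injective φ fun g g' h ↦ by
    have h1 := hφ g
    rw [h] at h1
    exact Subtype.ext (hasFunction_unique h1 (hφ g'))
  exact Set.toFinite _

theorem tail_comp_mem_sections {f g : ℤ_[p] → ℤ_[p]} (hg : g ∈ sections f) (d : ZMod p) :
    (fun x ↦ tail (g (d.val + p * x))) ∈ sections f := by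
  obtain ⟨k, r, hr, rfl⟩ := hg
  exact ⟨k + 1, r + p ^ k * d.val, add_pow_mul_lt_pow hr (ZMod.val_lt d),
    funext fun x ↦ (sect_succ f k r d.val x).symm⟩

theorem self_mem_sections (f : ℤ_[p] → ℤ_[p]) : f ∈ sections f :=
  ⟨0, 0, by simp, by ext1 x; simp [sect]⟩

/-- The automaton whose states are the sections of `f`. -/
noncomputable def sectionAutomaton (f : ℤ_[p] → ℤ_[p]) : Automaton (ZMod p) (sections f) where
  trans d g := ⟨_, tail_comp_mem_sections g.2 d⟩
  out d g := digit p 0 (g.1 d.val)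
  init := ⟨f, self_mem_sections f⟩

theorem sectionAutomaton_reachable (f : ℤ_[p] → ℤ_[p]) : (sectionAutomaton f).Reachable := by
  rintro ⟨_, k, r, hr, rfl⟩
  induction k generalizing r with
  | zero =>
    obtain rfl : r = 0 := by simpa using hr
    exact ⟨[], Subtype.ext (by ext1 x; simp [sect, sectionAutomaton])⟩
  | succ k ih =>
    obtain ⟨r, hr', d, hd, rfl⟩ := exists_eq_add_of_lt_pow hr
    obtain ⟨w, hw⟩ := ih r hr'
    refine ⟨w ++ [(d : ZMod p)], ?_⟩
    rw [List.foldl_append, hw]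
    refine Subtype.ext (funext fun x ↦ ?_)
    change tail (sect f k r ((d : ZMod p).val + p * x)) = sect f (k + 1) (r + p ^ k * d) x
    rw [sect_succ, ZMod.val_natCast_of_lt hd]

/-- The Lipschitz condition makes the lowest digit of `g z` depend only on that of `z`; higher
digits reduce to this by passing to the next section and to `tail z`. -/
theorem digit_section {f : ℤ_[p] → ℤ_[p]} (hf : LipschitzWith 1 f) (i : ℕ) (g : sections f)
    (z : ℤ_[p]) : digit p i (g.1 z) =
      (sectionAutomaton f).out (digit p i z) (((sectionAutomaton f).withInit g).stateAt z i) := by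
  induction i generalizing g z with
  | zero =>
    obtain ⟨_, k, r, hr, rfl⟩ := g
    refine digit_zero_eq_of_dvd ?_
    have := pow_dvd_sect_sub hf k r (n := 1) (x := z) (y := (digit p 0 z).val)
      ⟨tail z, by rw [pow_one]; nth_rw 1 [eq_digit_add_tail z]; ring⟩
    rwa [pow_one] at this
  | succ i ih =>
    have h1 := ih ((sectionAutomaton f).trans (digit p 0 z) g) (tail z)
    have h2 := stateAt_add_mul ((sectionAutomaton f).withInit g) (digit p 0 z) (tail z) i
    rw [← eq_digit_add_tail] at h2
    have h3 : ((sectionAutomaton f).trans (digit p 0 z) g).1 (tail z) = tail (g.1 z) := by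
      conv_rhs => rw [eq_digit_add_tail z]
      rfl
    rw [digit_succ, digit_succ, h2, ← h3]
    exact h1

theorem sectionAutomaton_hasFunction {f : ℤ_[p] → ℤ_[p]} (hf : LipschitzWith 1 f) :
    (sectionAutomaton f).HasFunction f :=
  fun z i ↦ digit_section hf i ⟨f, self_mem_sections f⟩ z

theorem isFiniteAutomatonFunction_iff {f : ℤ_[p] → ℤ_[p]} (hf : LipschitzWith 1 f) :
    IsFiniteAutomatonFunction f ↔ (sections f).Finite :=
  ⟨finite_sections_of_isFiniteAutomatonFunction, fun h ↦
    ⟨sections f, sectionAutomaton f, h, sectionAutomaton_reachable f,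
      sectionAutomaton_hasFunction hf⟩⟩

end Sections

end VdPAutomata

namespace VdPAutomata

/-- The `p`-kernel of a sequence. -/
def kernel {B : Type*} (p : ℕ) (b : ℕ → B) : Set (ℕ → B) :=
  {u | ∃ k, ∃ r < p ^ k, u = fun n ↦ b (r + p ^ k * n)}

/-! ### Van der Put coefficients against sections -/

section Coefficients

variable {p : ℕ} [Fact p.Prime] {f : ℤ_[p] → ℤ_[p]} {b : ℕ → ℤ_[p]}

theorem vdpChar_natCast (m n : ℕ) :
    vdpChar p m n = if n % p ^ (Nat.log p m + 1) = m then 1 else 0 := by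
  have hp := (Fact.out : p.Prime)
  rw [vdpChar]
  congr 1
  have h1 : ((n : ℤ_[p]) - m) = ((n - m : ℤ) : ℤ_[p]) := by push_cast; rfl
  have hm : m % p ^ (Nat.log p m + 1) = m :=
    Nat.mod_eq_of_lt (Nat.lt_pow_succ_log_self hp.one_lt m)
  rw [h1, PadicInt.norm_int_le_pow_iff_dvd]
  have h2 : n % p ^ (Nat.log p m + 1) = m ↔ m ≡ n [MOD p ^ (Nat.log p m + 1)] := by
    rw [Nat.ModEq, hm, eq_comm]
  rw [h2, Nat.modEq_iff_dvd]
  push_cast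
  rfl

theorem HasVanDerPutSeries.coeff_eq_of_lt (hb : HasVanDerPutSeries f b) {m : ℕ} (hm : m < p) :
    b m = f m := by
  have hp := (Fact.out : p.Prime)
  refine HasSum.unique ?_ (hb m)
  have h := hasSum_single (f := fun k : ℕ ↦ b k * (p : ℤ_[p]) ^ Nat.log p k * vdpChar p k m) m ?_
  · rwa [vdpChar_natCast, Nat.log_of_lt hm, if_pos (by simpa using Nat.mod_eq_of_lt hm), pow_zero,
      mul_one, mul_one] at h
  · intro k hk
    rw [vdpChar_natCast, if_neg, mul_zero]
    rw [Nat.mod_eq_of_lt (hm.trans_le (Nat.le_self_pow (Nat.succ_ne_zero _) p))]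
    exact hk.symm

/-- Among the balls of the series, only the one indexed by `m` separates `m` from `m` with its
leading digit removed. -/
theorem HasVanDerPutSeries.coeff_mul_pow (hb : HasVanDerPutSeries f b) {m : ℕ} (hm : p ≤ m) :
    b m * p ^ Nat.log p m = f m - f ((m % p ^ Nat.log p m : ℕ) : ℤ_[p]) := by
  have hp := (Fact.out : p.Prime)
  have hlog : 0 < Nat.log p m := Nat.log_pos hp.one_lt hm
  have hpow : p ^ Nat.log p m ≤ m := Nat.pow_log_le_self p (by have := hp.pos; omega)
  have hmod : m % p ^ Nat.log p m < p ^ Nat.log p m := Nat.mod_lt _ (pow_pos hp.pos _)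
  refine HasSum.unique ?_ ((hb m).sub (hb (m % p ^ Nat.log p m : ℕ)))
  have h := hasSum_single (f := fun k : ℕ ↦ b k * (p : ℤ_[p]) ^ Nat.log p k * vdpChar p k m -
    b k * (p : ℤ_[p]) ^ Nat.log p k * vdpChar p k (m % p ^ Nat.log p m : ℕ)) m ?_
  · rwa [vdpChar_natCast, vdpChar_natCast,
      if_pos (Nat.mod_eq_of_lt (Nat.lt_pow_succ_log_self hp.one_lt m)), if_neg, mul_one, mul_zero,
      sub_zero] at h
    intro h1
    have := Nat.mod_le (m % p ^ Nat.log p m) (p ^ (Nat.log p m + 1))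
    omega
  · intro k hk
    rw [← mul_sub, vdpChar_natCast, vdpChar_natCast]
    by_cases hkm : Nat.log p k < Nat.log p m
    · rw [Nat.mod_mod_of_dvd _ (pow_dvd_pow p hkm), sub_self, mul_zero]
    · have h1 : p ^ Nat.log p m ≤ p ^ Nat.log p k :=
        Nat.pow_le_pow_right hp.pos (not_lt.mp hkm)
      have hk0 : k ≠ 0 := by rintro rfl; exact hkm (by simpa using hlog)
      have h2 := Nat.pow_log_le_self p hk0
      have h3 : m < p ^ (Nat.log p k + 1) := (Nat.lt_pow_succ_log_self hp.one_lt m).trans_le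
        (Nat.pow_le_pow_right hp.pos (by omega))
      rw [Nat.mod_eq_of_lt h3, Nat.mod_eq_of_lt (by omega), if_neg hk.symm, if_neg (by omega),
        sub_self, mul_zero]

theorem log_add_pow_mul {k r n : ℕ} (hr : r < p ^ k) (hn : n ≠ 0) :
    Nat.log p (r + p ^ k * n) = k + Nat.log p n := by
  have hp := (Fact.out : p.Prime)
  have h1 := Nat.pow_log_le_self p hn
  have h2 := Nat.lt_pow_succ_log_self hp.one_lt n
  have hpk : 0 < p ^ k := pow_pos hp.pos k
  refine (Nat.log_eq_iff (Or.inr ⟨hp.one_lt, ?_⟩)).mpr ⟨?_, ?_⟩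
  · have := Nat.mul_pos hpk (Nat.pos_of_ne_zero hn)
    omega
  · rw [pow_add]
    exact (Nat.mul_le_mul_left _ h1).trans (Nat.le_add_left _ _)
  · rw [add_assoc, pow_add]
    exact add_mul_lt_mul hr h2

/-- Removing the leading digit of `r + p ^ (k + 1) * n` removes that of `n`. The exponent `k + 1`
forces the index to be at least `p`; below `p` a coefficient is a value of `f`, not a difference. -/
theorem HasVanDerPutSeries.sect_sub (hb : HasVanDerPutSeries f b) (hf : LipschitzWith 1 f)
    {k r n : ℕ} (hr : r < p ^ (k + 1)) (hn : n ≠ 0) :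
    sect f (k + 1) r n - sect f (k + 1) r ((n % p ^ Nat.log p n : ℕ) : ℤ_[p]) =
      p ^ Nat.log p n * b (r + p ^ (k + 1) * n) := by
  have hp := (Fact.out : p.Prime)
  have hle : p ≤ r + p ^ (k + 1) * n := by
    calc p ≤ p ^ (k + 1) := Nat.le_self_pow k.succ_ne_zero p
      _ ≤ p ^ (k + 1) * n := Nat.le_mul_of_pos_right _ (Nat.pos_of_ne_zero hn)
      _ ≤ _ := Nat.le_add_left _ _
  have h := hb.coeff_mul_pow hle
  have hmod : (r + p ^ (k + 1) * n) % p ^ (k + 1 + Nat.log p n) =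
      r + p ^ (k + 1) * (n % p ^ Nat.log p n) := by
    rw [pow_add p (k + 1) (Nat.log p n), Nat.mod_mul, Nat.add_mul_mod_self_left, Nat.mod_eq_of_lt hr,
      Nat.add_mul_div_left _ _ (pow_pos hp.pos _), Nat.div_eq_of_lt hr, zero_add]
  rw [log_add_pow_mul hr hn, hmod] at h
  apply mul_left_cancel₀ (pow_ne_zero (k + 1) (p_ne_zero (p := p)))
  rw [pow_mul_sect_sub hf, ← mul_assoc, ← pow_add, mul_comm _ (b _), h]
  push_cast
  rfl

/-- Splitting off the leading digit `d` of an index `m ≥ p` gives `b m = g d - g 0` for a section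
`g`. -/
theorem finite_range_of_finite_sections (hb : HasVanDerPutSeries f b) (hf : LipschitzWith 1 f)
    (hfin : (sections f).Finite) : (Set.range b).Finite := by
  have hp := (Fact.out : p.Prime)
  refine ((((Set.finite_Iio p).image b)).union
    ((hfin.prod (Set.finite_Iio p)).image fun x ↦ x.1 (x.2 : ℤ_[p]) - x.1 0)).subset ?_
  rintro _ ⟨m, rfl⟩
  by_cases hm : m < p
  · exact Or.inl ⟨m, hm, rfl⟩
  · obtain ⟨k, hk⟩ : ∃ k, Nat.log p m = k + 1 :=
      Nat.exists_eq_succ_of_ne_zero (Nat.log_pos hp.one_lt (not_lt.mp hm)).ne'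
    have hr : m % p ^ (k + 1) < p ^ (k + 1) := Nat.mod_lt _ (pow_pos hp.pos _)
    have hm0 : m ≠ 0 := by have := hp.pos; omega
    have hd : m / p ^ (k + 1) < p := by
      apply Nat.div_lt_of_lt_mul
      rw [← pow_succ, ← hk]
      exact Nat.lt_pow_succ_log_self hp.one_lt m
    have hd0 : m / p ^ (k + 1) ≠ 0 := by
      have := Nat.pow_log_le_self p hm0
      rw [hk] at this
      exact (Nat.div_pos this (pow_pos hp.pos _)).ne'
    refine Or.inr ⟨(sect f (k + 1) (m % p ^ (k + 1)), m / p ^ (k + 1)),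
      ⟨⟨k + 1, _, hr, rfl⟩, hd⟩, ?_⟩
    have h := hb.sect_sub hf hr hd0
    rw [Nat.log_of_lt hd, pow_zero, Nat.mod_one, pow_zero, one_mul, Nat.mod_add_div] at h
    simpa using h

theorem finite_kernel_of_finite_sections (hb : HasVanDerPutSeries f b) (hf : LipschitzWith 1 f)
    (hfin : (sections f).Finite) : (kernel p b).Finite := by
  have hp := (Fact.out : p.Prime)
  have hB := finite_range_of_finite_sections hb hf hfin
  set U : Set (ℕ → ℤ_[p]) := {u | ∃ k, ∃ r < p ^ (k + 1), u = fun n ↦ b (r + p ^ (k + 1) * n)}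
  have hU : U.Finite := by
    -- The section determines `u n` only for `n ≠ 0`; the second component records `u 0`.
    have hex : ∀ u : U, ∃ x : sections f × Set.range b, x.2.1 = u.1 0 ∧ ∀ n : ℕ, n ≠ 0 →
        x.1.1 n - x.1.1 ((n % p ^ Nat.log p n : ℕ) : ℤ_[p]) = p ^ Nat.log p n * u.1 n := by
      rintro ⟨_, k, r, hr, rfl⟩
      exact ⟨⟨⟨_, k + 1, r, hr, rfl⟩, ⟨_, r, rfl⟩⟩, by simp, fun n hn ↦ hb.sect_sub hf hr hn⟩
    choose φ hφ0 hφ using hex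
    have : Finite (sections f) := hfin
    have : Finite (Set.range b) := hB
    have : Finite U := Finite.of_injective φ fun u v h ↦ by
      refine Subtype.ext (funext fun n ↦ ?_)
      by_cases hn : n = 0
      · rw [hn, ← hφ0, ← hφ0, h]
      · have h1 := hφ u n hn
        rw [h, hφ v n hn] at h1
        exact (mul_left_cancel₀ (pow_ne_zero _ p_ne_zero) h1).symm
    exact Set.toFinite U
  refine (hU.insert b).subset ?_
  rintro _ ⟨k, r, hr, rfl⟩
  cases k with
  | zero =>
    obtain rfl : r = 0 := by simpa using hr
    exact Or.inl (by ext n; simp)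
  | succ k => exact Or.inr ⟨k, r, hr, rfl⟩

theorem mem_rationalPadicInts_iff {x : ℤ_[p]} : x ∈ rationalPadicInts p ↔
    (x : ℚ_[p]) ∈ (algebraMap ℚ ℚ_[p]).fieldRange := by
  simp only [rationalPadicInts, Set.mem_ofPred_eq, RingHom.mem_fieldRange, eq_ratCast]
  exact exists_congr fun q ↦ eq_comm

/-- A repeated shift `t` satisfies `t = a' + p ^ (c + 1) * t`, so it is rational, and so is `x`. -/
theorem mem_rationalPadicInts_of_finite_orbit {x : ℤ_[p]} {s : Set ℤ_[p]} (hs : s.Finite) (N : ℕ)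
    (h : ∀ k, tail^[N + k] x ∈ s) : x ∈ rationalPadicInts p := by
  have hp := (Fact.out : p.Prime)
  obtain ⟨i, j, hij, heq⟩ := hs.exists_lt_map_eq_of_forall_mem h
  obtain ⟨c, rfl⟩ := Nat.exists_eq_add_of_lt hij
  obtain ⟨a, ha⟩ := exists_eq_add_pow_mul_tail_iterate x (N + i)
  obtain ⟨a', ha'⟩ := exists_eq_add_pow_mul_tail_iterate (tail^[N + i] x) (c + 1)
  rw [← Function.iterate_add_apply, show c + 1 + (N + i) = N + (i + c + 1) by ring, ← heq] at ha'
  set t := tail^[N + i] x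
  rw [mem_rationalPadicInts_iff]
  set Q := (algebraMap ℚ ℚ_[p]).fieldRange
  have hne : (1 - (p : ℚ_[p]) ^ (c + 1)) ≠ 0 := by
    rw [sub_ne_zero]
    have : (1 : ℕ) ≠ p ^ (c + 1) := (Nat.one_lt_pow c.succ_ne_zero hp.one_lt).ne
    exact_mod_cast this
  have ht : (t : ℚ_[p]) ∈ Q := by
    have h1 : (t : ℚ_[p]) = a' / (1 - (p : ℚ_[p]) ^ (c + 1)) := by
      rw [eq_div_iff hne]
      have h2 : (t : ℚ_[p]) = a' + (p : ℚ_[p]) ^ (c + 1) * t := by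
        exact_mod_cast congrArg (fun z : ℤ_[p] ↦ (z : ℚ_[p])) ha'
      linear_combination h2
    rw [h1]
    exact Q.div_mem (natCast_mem Q _) (Q.sub_mem Q.one_mem (Q.pow_mem (natCast_mem Q _) _))
  have h3 : (x : ℚ_[p]) = a + (p : ℚ_[p]) ^ (N + i) * t := by
    exact_mod_cast congrArg (fun z : ℤ_[p] ↦ (z : ℚ_[p])) ha
  rw [h3]
  exact Q.add_mem (natCast_mem Q _) (Q.mul_mem (Q.pow_mem (natCast_mem Q _) _) ht)

theorem apply_natCast_mem_rationalPadicInts (hfin : (sections f).Finite) (r : ℕ) :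
    f r ∈ rationalPadicInts p := by
  have hp := (Fact.out : p.Prime)
  -- Since `r < p ^ (r + k)`, deleting `r + k` digits of `f r` gives the value at 0 of a section.
  refine mem_rationalPadicInts_of_finite_orbit (hfin.image fun g ↦ g 0) r fun k ↦ ?_
  refine ⟨sect f (r + k) r, ⟨r + k, r, ?_, rfl⟩, by simp [sect]⟩
  exact (Nat.lt_pow_self hp.one_lt).trans_le (Nat.pow_le_pow_right hp.pos (Nat.le_add_right _ _))

theorem range_subset_rationalPadicInts (hb : HasVanDerPutSeries f b)
    (hfin : (sections f).Finite) : Set.range b ⊆ rationalPadicInts p := by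
  have hp := (Fact.out : p.Prime)
  rintro _ ⟨m, rfl⟩
  by_cases hm : m < p
  · rw [hb.coeff_eq_of_lt hm]
    exact apply_natCast_mem_rationalPadicInts hfin m
  · have h := congrArg (fun z : ℤ_[p] ↦ (z : ℚ_[p])) (hb.coeff_mul_pow (not_lt.mp hm))
    push_cast at h
    have hne : (p : ℚ_[p]) ^ Nat.log p m ≠ 0 := pow_ne_zero _ (Nat.cast_ne_zero.mpr hp.ne_zero)
    rw [← eq_div_iff hne] at h
    rw [mem_rationalPadicInts_iff, h]
    have h1 := fun r : ℕ ↦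
      mem_rationalPadicInts_iff.mp (apply_natCast_mem_rationalPadicInts hfin r)
    exact Subfield.div_mem _ (Subfield.sub_mem _ (h1 _) (by exact_mod_cast h1 _))
      (Subfield.pow_mem _ (natCast_mem _ _) _)

theorem exists_common_denominator {B : Set ℤ_[p]} (hB : B.Finite)
    (hrat : B ⊆ rationalPadicInts p) :
    ∃ N M : ℕ, 0 < N ∧ ∀ β ∈ B, ∃ z : ℤ, N * β = z ∧ |z| ≤ M := by
  induction B, hB using Set.Finite.induction_on with
  | empty => exact ⟨1, 0, one_pos, by simp⟩
  | @insert β B _ _ ih =>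
    obtain ⟨N, M, hN, h⟩ := ih ((Set.subset_insert _ _).trans hrat)
    obtain ⟨x, hx⟩ := hrat (Set.mem_insert _ _)
    have hβ : x.den * β = x.num := by
      have h1 : (x.den : ℚ_[p]) * β = x.num := by
        rw [hx]
        exact_mod_cast congrArg (fun y : ℚ ↦ (y : ℚ_[p])) (Rat.den_mul_eq_num x)
      exact PadicInt.ext (by push_cast; exact h1)
    refine ⟨N * x.den, M * x.den + N * x.num.natAbs, Nat.mul_pos hN x.pos, ?_⟩
    rintro γ (rfl | hγ)
    · refine ⟨N * x.num, by push_cast; rw [mul_assoc, hβ], ?_⟩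
      rw [abs_mul]
      push_cast
      rw [abs_of_nonneg (Int.natCast_nonneg N)]
      exact le_add_of_nonneg_left (by positivity)
    · obtain ⟨z, hz, hzM⟩ := h γ hγ
      refine ⟨x.den * z, by push_cast; rw [← hz]; ring, ?_⟩
      rw [abs_mul, abs_of_nonneg (Int.natCast_nonneg x.den)]
      push_cast
      have : (x.den : ℤ) * |z| ≤ x.den * M := by gcongr
      have : 0 ≤ (N : ℤ) * |x.num| := by positivity
      linarith

/-- Fractions over a common denominator `N` with numerator at most `M + N * p` in absolute value
form such a set: adding `β` and subtracting a digit at most doubles that bound, and the shift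
divides by `p ≥ 2`. -/
theorem exists_finite_carries {B : Set ℤ_[p]} (hB : B.Finite) (hrat : B ⊆ rationalPadicInts p) :
    ∃ C : Set ℤ_[p], C.Finite ∧ 0 ∈ C ∧ ∀ c ∈ C, tail c ∈ C ∧ ∀ β ∈ B, tail (c + β) ∈ C := by
  have hp := (Fact.out : p.Prime)
  obtain ⟨N, M, hN, hNM⟩ := exists_common_denominator hB hrat
  set C : Set ℤ_[p] := {c | ∃ z : ℤ, N * c = z ∧ |z| ≤ M + N * p} with hC
  have hN0 : (N : ℤ_[p]) ≠ 0 := Nat.cast_ne_zero.mpr hN.ne'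
  have hstep : ∀ c ∈ C, ∀ β : ℤ_[p], (∃ z : ℤ, N * β = z ∧ |z| ≤ M) → tail (c + β) ∈ C := by
    rintro c ⟨z, hz, hzM⟩ β ⟨y, hy, hyM⟩
    have hd := eq_digit_add_tail (c + β)
    have hlt := ZMod.val_lt (digit p 0 (c + β))
    set d := (digit p 0 (c + β)).val
    set t := tail (c + β)
    have h1 : (p : ℤ_[p]) * (N * t) = ((z + y - N * d : ℤ) : ℤ_[p]) := by
      push_cast
      rw [← hz, ← hy]
      linear_combination -(N : ℤ_[p]) * hd
    obtain ⟨w, hw⟩ : (p : ℤ) ∣ z + y - N * d := by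
      have h2 := (PadicInt.norm_int_le_pow_iff_dvd (p := p) (k := z + y - N * d) (n := 1)).mp (by
        rw [← h1, PadicInt.norm_le_pow_iff_mem_span_pow, pow_one]
        exact Ideal.mem_span_singleton.mpr (dvd_mul_right _ _))
      simpa using h2
    refine ⟨w, ?_, ?_⟩
    · rw [hw] at h1
      push_cast at h1
      exact mul_left_cancel₀ p_ne_zero h1
    · have h3 : (2 : ℤ) ≤ p := by exact_mod_cast hp.two_le
      have h4 : (N : ℤ) * d ≤ N * p := by
        have : (d : ℤ) ≤ p := by exact_mod_cast hlt.le
        gcongr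
      have h5 : 0 ≤ (N : ℤ) * d := by positivity
      have h6 : (p : ℤ) * |w| ≤ 2 * (M + N * p) := by
        have h7 : |(p : ℤ) * w| = p * |w| := by
          rw [abs_mul, abs_of_nonneg (Int.natCast_nonneg p)]
        rw [← h7, ← hw, abs_le]
        rw [abs_le] at hzM hyM
        constructor <;> linarith [hzM.1, hzM.2, hyM.1, hyM.2]
      nlinarith [abs_nonneg w]
  refine ⟨C, ?_, ⟨0, by simp, by positivity⟩, fun c hc ↦ ⟨?_, fun β hβ ↦ hstep c hc β (hNM β hβ)⟩⟩
  · refine Set.Finite.of_finite_image (f := fun c ↦ (N : ℤ_[p]) * c)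
      (((Set.finite_Icc (-(M + N * p : ℤ)) (M + N * p)).image
        fun z : ℤ ↦ (z : ℤ_[p])).subset ?_) fun _ _ _ _ h ↦ mul_left_cancel₀ hN0 h
    rintro _ ⟨c, ⟨z, hz, hzM⟩, rfl⟩
    exact ⟨z, abs_le.mp hzM, hz.symm⟩
  · simpa using hstep c hc 0 ⟨0, by simp, by simp⟩

/-- Appending the digit 0 to the word shifts the value at 0; appending `d ≠ 0` first adds a
coefficient, by `sect_sub` at `n = d`. -/
theorem sect_zero_mem (hb : HasVanDerPutSeries f b) (hf : LipschitzWith 1 f) {C : Set ℤ_[p]}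
    (h0 : 0 ∈ C) (hC : ∀ c ∈ C, tail c ∈ C ∧ ∀ β ∈ Set.range b, tail (c + β) ∈ C) (k : ℕ) :
    ∀ r < p ^ (k + 1), sect f (k + 1) r 0 ∈ C := by
  induction k with
  | zero =>
    intro r hr
    have h := (hC 0 h0).2 (b r) ⟨r, rfl⟩
    rw [zero_add, hb.coeff_eq_of_lt (by simpa using hr)] at h
    simpa [sect] using h
  | succ k ih =>
    intro r hr
    obtain ⟨r, hr', d, hd, rfl⟩ := exists_eq_add_of_lt_pow hr
    rw [sect_succ, mul_zero, add_zero]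
    by_cases hd0 : d = 0
    · rw [hd0, Nat.cast_zero]
      exact (hC _ (ih r hr')).1
    · have h := hb.sect_sub hf hr' hd0
      rw [Nat.log_of_lt hd, pow_zero, Nat.mod_one, Nat.cast_zero, pow_zero, one_mul,
        sub_eq_iff_eq_add'] at h
      rw [h]
      exact (hC _ (ih r hr')).2 _ ⟨_, rfl⟩

theorem finite_sections_of_finite_kernel (hb : HasVanDerPutSeries f b) (hf : LipschitzWith 1 f)
    (hB : (Set.range b).Finite) (hrat : Set.range b ⊆ rationalPadicInts p)
    (hker : (kernel p b).Finite) : (sections f).Finite := by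
  have hp := (Fact.out : p.Prime)
  obtain ⟨C, hCfin, h0, hC⟩ := exists_finite_carries hB hrat
  set G : Set (ℤ_[p] → ℤ_[p]) := {g | ∃ k, ∃ r < p ^ (k + 1), g = sect f (k + 1) r}
  have hG : G.Finite := by
    have hex : ∀ g : G, ∃ x : C × kernel p b, x.1.1 = g.1 0 ∧ ∀ n : ℕ, n ≠ 0 →
        g.1 n - g.1 ((n % p ^ Nat.log p n : ℕ) : ℤ_[p]) = p ^ Nat.log p n * x.2.1 n := by
      rintro ⟨_, k, r, hr, rfl⟩
      exact ⟨⟨⟨_, sect_zero_mem hb hf h0 hC k r hr⟩, ⟨_, k + 1, r, hr, rfl⟩⟩, rfl,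
        fun n hn ↦ hb.sect_sub hf hr hn⟩
    choose φ hφ0 hφ using hex
    have : Finite C := hCfin
    have : Finite (kernel p b) := hker
    have : Finite G := Finite.of_injective φ fun g g' h ↦ by
      -- Recovery on the naturals removes one leading digit at a time; the Lipschitz property then
      -- extends the equality to `ℤ_[p]`.
      have hnat : ∀ n : ℕ, g.1 n = g'.1 n := by
        intro n
        induction n using Nat.strong_induction_on with
        | _ n ih =>
          by_cases hn : n = 0
          · rw [hn, Nat.cast_zero, ← hφ0, ← hφ0, h]
          · have h1 := hφ g n hn
            rw [h, ← hφ g' n hn, ih _ ((Nat.mod_lt _ (pow_pos hp.pos _)).trans_le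
              (Nat.pow_log_le_self p hn))] at h1
            exact sub_left_injective h1
      have hdvd : ∀ (g : G) (x : ℤ_[p]) (n : ℕ), (p : ℤ_[p]) ^ n ∣ g.1 x - g.1 (x.appr n) := by
        rintro ⟨_, k, r, hr, rfl⟩ x n
        exact pow_dvd_sect_sub hf _ _ (Ideal.mem_span_singleton.mp (PadicInt.appr_spec n x))
      refine Subtype.ext (funext fun x ↦ sub_eq_zero.mp (eq_zero_of_forall_pow_dvd fun n ↦ ?_))
      have h1 := dvd_sub (hdvd g x n) (hdvd g' x n)
      rwa [hnat, sub_sub_sub_cancel_right] at h1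
    exact Set.toFinite G
  refine (hG.insert f).subset ?_
  rintro _ ⟨k, r, hr, rfl⟩
  cases k with
  | zero =>
    obtain rfl : r = 0 := by simpa using hr
    exact Or.inl (by ext1 x; simp [sect])
  | succ k => exact Or.inr ⟨k, r, hr, rfl⟩

end Coefficients

end VdPAutomata

namespace VdPAutomata

/-! ### The `p`-kernel and Christol's theorem over a field with `p ^ ℓ` elements -/

section Kernel

variable {B : Type*} {p : ℕ}

/-- A sequence lying in a finite set of sequences that is closed under extracting arithmetic
progressions modulo `p ^ ℓ` has a finite `p`-kernel. -/
theorem finite_kernel_of_finite_closed (hp : 0 < p) {ℓ : ℕ} (hℓ : 0 < ℓ) {b : ℕ → B}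
    {U : Set (ℕ → B)} (hU : U.Finite) (hb : b ∈ U)
    (hcl : ∀ u ∈ U, ∀ r < p ^ ℓ, (fun n ↦ u (p ^ ℓ * n + r)) ∈ U) : (kernel p b).Finite := by
  have hmem : ∀ j : ℕ, ∀ r < p ^ (ℓ * j), (fun n ↦ b (r + p ^ (ℓ * j) * n)) ∈ U := by
    intro j
    induction j with
    | zero =>
      intro r hr
      obtain rfl : r = 0 := by simpa using hr
      simpa using hb
    | succ j ih =>
      intro r hr
      have hpos : 0 < p ^ (ℓ * j) := pow_pos hp _
      have hlt : r / p ^ (ℓ * j) < p ^ ℓ :=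
        Nat.div_lt_of_lt_mul (by rwa [← pow_add, ← Nat.mul_succ])
      have h := hcl _ (ih _ (Nat.mod_lt r hpos)) _ hlt
      convert h using 2 with n
      congr 1
      nth_rw 1 [← Nat.mod_add_div r (p ^ (ℓ * j))]
      rw [Nat.mul_succ, pow_add]
      ring
  -- Closure reaches only exponents divisible by `ℓ`; the remainder `k % ℓ` costs finitely many
  -- further progressions.
  refine ((hU.prod ((Set.finite_Iio ℓ).prod (Set.finite_Iio (p ^ ℓ)))).image
    fun x : (ℕ → B) × ℕ × ℕ ↦ fun n ↦ x.1 (x.2.2 + p ^ x.2.1 * n)).subset ?_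
  rintro _ ⟨k, r, hr, rfl⟩
  have hpos : 0 < p ^ (ℓ * (k / ℓ)) := pow_pos hp _
  have hk : ℓ * (k / ℓ) + k % ℓ = k := Nat.div_add_mod k ℓ
  have hlt : r / p ^ (ℓ * (k / ℓ)) < p ^ (k % ℓ) :=
    Nat.div_lt_of_lt_mul (by rwa [← pow_add, hk])
  refine ⟨⟨_, k % ℓ, r / p ^ (ℓ * (k / ℓ))⟩, ⟨hmem (k / ℓ) _ (Nat.mod_lt r hpos),
    Nat.mod_lt _ hℓ, hlt.trans_le (Nat.pow_le_pow_right hp (Nat.mod_lt _ hℓ).le)⟩, ?_⟩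
  ext n
  dsimp only
  congr 1
  rw [mul_add, ← add_assoc, Nat.mod_add_div, ← mul_assoc, ← pow_add, hk]

theorem kernel_closed {b u : ℕ → B} (hu : u ∈ kernel p b) {ℓ s : ℕ} (hs : s < p ^ ℓ) :
    (fun n ↦ u (p ^ ℓ * n + s)) ∈ kernel p b := by
  obtain ⟨k, r, hr, rfl⟩ := hu
  refine ⟨k + ℓ, r + p ^ k * s, ?_, ?_⟩
  · rw [pow_add]
    exact add_mul_lt_mul hr hs
  · ext n
    exact congrArg b (by rw [pow_add]; ring)

theorem self_mem_kernel (b : ℕ → B) : b ∈ kernel p b := ⟨0, 0, by simp, by ext n; simp⟩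

open scoped RatFunc in
/-- Christol's theorem. -/
theorem finite_kernel_iff_isAlgebraic {K : Type*} [Field K] [Fintype K] {ℓ : ℕ} (hp : 0 < p)
    (hℓ : 0 < ℓ) (hK : Fintype.card K = p ^ ℓ) (b : ℕ → K) : (kernel p b).Finite ↔
      IsAlgebraic (RatFunc K) ((PowerSeries.mk b : PowerSeries K) : LaurentSeries K) := by
  constructor
  · intro h
    refine isAlgebraic_of_finite_cartier (PowerSeries.mk '' kernel p b) (h.image _) ?_
      ⟨b, self_mem_kernel b, rfl⟩
    rintro _ ⟨u, hu, rfl⟩ r hr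
    rw [hK] at hr
    refine ⟨_, kernel_closed hu hr, ?_⟩
    ext n
    simp [cartier, hK]
  · intro h
    obtain ⟨𝓕, hfin, hmem, hcl⟩ := exists_finite_cartier_of_isAlgebraic h
    refine finite_kernel_of_finite_closed hp hℓ
      (hfin.image fun F n ↦ PowerSeries.coeff n F) ⟨_, hmem, by ext n; simp⟩ ?_
    rintro _ ⟨F, hF, rfl⟩ r hr
    refine ⟨_, hcl F hF r (by rwa [hK]), ?_⟩
    ext n
    simp [cartier, hK]

theorem finite_kernel_comp_iff {B' : Type*} {τ : B → B'} (hτ : Function.Injective τ) (b : ℕ → B) :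
    (kernel p fun n ↦ τ (b n)).Finite ↔ (kernel p b).Finite := by
  have h : (kernel p fun n ↦ τ (b n)) = (fun u n ↦ τ (u n)) '' kernel p b := by
    ext u
    constructor
    · rintro ⟨k, r, hr, rfl⟩
      exact ⟨_, ⟨k, r, hr, rfl⟩, rfl⟩
    · rintro ⟨_, ⟨k, r, hr, rfl⟩, rfl⟩
      exact ⟨k, r, hr, rfl⟩
  rw [h, Set.finite_image_iff]
  exact fun u _ v _ huv ↦ funext fun n ↦ hτ (congrFun huv n)

theorem exists_injective_galoisField (p : ℕ) [Fact p.Prime] (B : Type*) [Finite B] :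
    ∃ ℓ : ℕ, 0 < ℓ ∧ ∃ τ : B → GaloisField p ℓ, Function.Injective τ := by
  have hp := (Fact.out : p.Prime)
  -- The added 1 keeps the exponent positive even for empty `B`.
  refine ⟨Nat.card B + 1, Nat.succ_pos _, ?_⟩
  have hcard := GaloisField.card p (Nat.card B + 1) (Nat.succ_ne_zero _)
  have := Fintype.ofFinite B
  have := Fintype.ofFinite (GaloisField p (Nat.card B + 1))
  have hle : Fintype.card B ≤ Fintype.card (GaloisField p (Nat.card B + 1)) := by
    rw [← Nat.card_eq_fintype_card, ← Nat.card_eq_fintype_card, hcard]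
    exact (Nat.lt_pow_self hp.one_lt).le.trans (Nat.pow_le_pow_right hp.pos (Nat.le_succ _))
  obtain ⟨e⟩ := Function.Embedding.nonempty_of_card_le hle
  exact ⟨e, e.injective⟩

end Kernel

end VdPAutomata

open VdPAutomata RatFunc in
theorem theorem4p5 (p : ℕ) [Fact p.Prime] (f : ℤ_[p] → ℤ_[p]) (hf : LipschitzWith 1 f)
    (b : ℕ → ℤ_[p]) (hb : HasVanDerPutSeries f b) :
    IsFiniteAutomatonFunction f ↔
      ((Set.range b).Finite ∧ Set.range b ⊆ rationalPadicInts p) ∧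
      ∃ ℓ : ℕ, 0 < ℓ ∧ ∃ τ : Set.range b → GaloisField p ℓ, Function.Injective τ ∧
        IsAlgebraic (RatFunc (GaloisField p ℓ))
          ((PowerSeries.mk (fun m : ℕ => τ ⟨b m, Set.mem_range_self m⟩) :
            PowerSeries (GaloisField p ℓ)) : LaurentSeries (GaloisField p ℓ)) := by
  have hp := (Fact.out : p.Prime)
  -- Finiteness of the kernel survives any injective recoding, so the condition holds for one `τ`
  -- iff it holds for all.
  have halg : ∀ {ℓ : ℕ} (_ : 0 < ℓ) {τ : Set.range b → GaloisField p ℓ}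
      (_ : Function.Injective τ), (kernel p b).Finite ↔ IsAlgebraic (RatFunc (GaloisField p ℓ))
          ((PowerSeries.mk (fun m : ℕ => τ ⟨b m, Set.mem_range_self m⟩) :
            PowerSeries (GaloisField p ℓ)) : LaurentSeries (GaloisField p ℓ)) := by
    intro ℓ hℓ τ hτ
    have := Fintype.ofFinite (GaloisField p ℓ)
    rw [← finite_kernel_iff_isAlgebraic hp.pos hℓ
      (by rw [← Nat.card_eq_fintype_card, GaloisField.card p ℓ hℓ.ne']),
      finite_kernel_comp_iff hτ, ← finite_kernel_comp_iff Subtype.val_injective]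
  rw [isFiniteAutomatonFunction_iff hf]
  constructor
  · intro h
    have hB := finite_range_of_finite_sections hb hf h
    have : Finite (Set.range b) := hB
    obtain ⟨ℓ, hℓ, τ, hτ⟩ := exists_injective_galoisField p (Set.range b)
    exact ⟨⟨hB, range_subset_rationalPadicInts hb h⟩, ℓ, hℓ, τ, hτ,
      (halg hℓ hτ).mp (finite_kernel_of_finite_sections hb hf h)⟩
  · rintro ⟨⟨hB, hrat⟩, ℓ, hℓ, τ, hτ, h⟩
    exact finite_sections_of_finite_kernel hb hf hB hrat ((halg hℓ hτ).mpr h)
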